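/- **Theorem 3.2.** Let $d\ge 0$ be an integer, let $e_0,\dots,e_d$ be the standard basis of $\mathbb C^{d+1}$, let $\mathbb D\subset\mathbb C$ be the open unit disk, and for $0\le i\le d$ let $$Z_i=\Big\{e_i+\sum_{j=i+1}^{d}z_j e_j : z_{i+1},\dots,z_d\in\mathbb C\Big\}.$$ *Line type.* Let $\Omega\subset\mathbb C^{d+1}$ be a convex domain with $C^\infty$ boundary and $\xi\in\partial\Omega$. After a complex affine change of coordinates assume $\xi=0$ and $\Omega\subset\{\operatorname{Im} z_0>0\}$ (so that $T_\xi\partial\Omega=\mathbb R\times\mathbb C^d$). There are open neighbourhoods $U,V\subset\mathbb R$ and $W\subset\mathbb C^d$ of the origins and a $C^\infty$ function $F:U\times W\to V$ with $$\Omega\cap\big((U+iV)\times W\big)=\{(x+iy,z)\in (U+iV)\times W : y>F(x,z)\}.$$ Put $f(z)=F(0,z)$. For $v\in\mathbb C^d$ let $\operatorname{ord}(f;v)\in\mathbb N\cup\{\infty\}$ be the order of vanishing at $\zeta=0$ of $\zeta\mapsto f(\zeta v)$ ($\zeta\in\mathbb C$), and for $r\in\mathbb N\cup\{\infty\}$ let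 $V_r$ be the complex linear subspace $\{v\in\mathbb C^d:\operatorname{ord}(f;v)\ge r\}$. The *line type* of $\xi$ is the nondecreasing $d$-tuple $m(\xi)=(m_1,\dots,m_d)\in(\mathbb N\cup\{\infty\})^d$ with $$m_j=\max\{r\in\mathbb N\cup\{\infty\}:\dim_{\mathbb C}V_r\ge d-j+1\};$$ it does not depend on the choice of coordinates. *Convergence.* Let $\mathbb X_{d+1,0}$ be the set of pairs $(\Omega,x)$ where $\Omega\subset\mathbb C^{d+1}$ is a convex domain containing no complex affine line and $x\in\Omega$. A sequence $(\Omega_n,x_n)$ converges to $(\Omega_\infty,x_\infty)$ in $\mathbb X_{d+1,0}$ if $x_n\to x_\infty$ and there is $R_0\ge 0$ such that, for every $R\ge R_0$, the Hausdorff distance between $\overline{\Omega_n}\cap\{\|z\|\le R\}$ and $\overline{\Omega_\infty}\cap\{\|z\|\le R\}$ tends to $0$ as $n\to\infty$. *Statement.* Suppose that $\Omega\subset\mathbb C^{d+1}$ is a bounded convex domain with $C^\infty$ boundary, $\xi\in\partial\Omega$, and $m(\xi)\notin\mathbb N^d$ (that is, some entry of $m(\xi)$ is $\infty$; in particular $d\ge1$).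 Then there exist points $x_n\in\Omega$ converging to $\xi$, complex affine automorphisms $A_n$ of $\mathbb C^{d+1}$, and a domain $\widehat\Omega$ such that $$(A_n\Omega,A_nx_n)\longrightarrow(\widehat\Omega,0)\quad\text{in }\mathbb X_{d+1,0}$$ and 1. $\mathbb D e_i\subset\widehat\Omega$ for $0\le i\le d$, 2. $Z_i\cap\widehat\Omega=\emptyset$ for $0\le i\le d$, 3. $e_0+\mathbb D e_1\subset\partial\widehat\Omega$. -/

import Mathlib

open scoped ContDiff

/-- `ℂⁿ` with its standard Hermitian inner product and Euclidean norm. -/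
abbrev Cn (n : ℕ) : Type := EuclideanSpace ℂ (Fin n)

/-- The `i`-th standard basis vector of `ℂⁿ` (indices start at `0`). -/
noncomputable def stdVec {n : ℕ} (i : Fin n) : Cn n := EuclideanSpace.single i (1 : ℂ)

/-! ### Convex domains and the local Hausdorff topology -/

/-- The set of convex domains in `ℂⁿ` which contain no complex affine line
`{b + ζ a : ζ ∈ ℂ}`, `a ≠ 0`. -/
def ConvexDomains (n : ℕ) : Set (Set (Cn n)) :=
  {Ω | IsOpen Ω ∧ Ω.Nonempty ∧ Convex ℝ Ω ∧
    ∀ a b : Cn n, a ≠ 0 → ¬ ∀ ζ : ℂ, b + ζ • a ∈ Ω}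

/-- The set of pairs `(Ω, x)` with `Ω` in `ConvexDomains n` and `x ∈ Ω`. -/
def PointedConvexDomains (n : ℕ) : Set (Set (Cn n) × Cn n) :=
  {p | p.1 ∈ ConvexDomains n ∧ p.2 ∈ p.1}

/-- The Hausdorff distance between the parts of `A` and of `B` in the closed ball of radius `R`
about the origin, with values in `[0, ∞]` (it is `∞` if exactly one of the two parts is empty). -/
noncomputable def localHausdorffEDist {n : ℕ} (R : ℝ) (A B : Set (Cn n)) : ENNReal :=
  Metric.hausdorffEDist (A ∩ Metric.closedBall 0 R) (B ∩ Metric.closedBall 0 R)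

/-- Convergence of open convex sets in the local Hausdorff topology. -/
def LocalHausdorffTendsto {n : ℕ} (A : ℕ → Set (Cn n)) (B : Set (Cn n)) : Prop :=
  ∃ R₀ : ℝ, 0 ≤ R₀ ∧ ∀ R : ℝ, R₀ ≤ R →
    Filter.Tendsto (fun k => localHausdorffEDist R (closure (A k)) (closure B))
      Filter.atTop (nhds 0)

/-- Convergence `pₖ → q` in the space of pointed convex domains without complex affine lines:
all the pairs belong to that space, the domains converge in the local Hausdorff topology, and the
base points converge. -/
def PointedTendsto {n : ℕ} (p : ℕ → Set (Cn n) × Cn n) (q : Set (Cn n) × Cn n) : Prop :=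
  (∀ k, p k ∈ PointedConvexDomains n) ∧ q ∈ PointedConvexDomains n ∧
    LocalHausdorffTendsto (fun k => (p k).1) q.1 ∧
    Filter.Tendsto (fun k => (p k).2) Filter.atTop (nhds q.2)

/-! ### Domains with smooth boundary -/

/-- The open set `Ω` has `C^∞` boundary: near each of its boundary points it is the sublevel set
`{ρ < 0}` of a real-valued `C^∞` function `ρ` without critical points. -/
def HasSmoothBoundary {n : ℕ} (Ω : Set (Cn n)) : Prop :=
  ∀ ξ ∈ frontier Ω, ∃ (U : Set (Cn n)) (ρ : Cn n → ℝ), IsOpen U ∧ ξ ∈ U ∧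
    ContDiffOn ℝ ∞ ρ U ∧ (∀ z ∈ U, fderiv ℝ ρ z ≠ 0) ∧ Ω ∩ U = {z ∈ U | ρ z < 0}

/-! ### Line type -/

/-- The order of vanishing at `0` of a function `g` of one complex variable which is smooth (in the
real sense) near `0`: the least order of a nonzero derivative of `g` at `0`, and `∞` if all of
them vanish. -/
noncomputable def vanishingOrder (g : ℂ → ℝ) : ℕ∞ :=
  sInf {r : ℕ∞ | ∃ k : ℕ, r = k ∧ iteratedFDeriv ℝ k g 0 ≠ 0}

/-- `ord(f; v)`: the order of vanishing at `ζ = 0` of `ζ ↦ f (ζ v)`. -/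
noncomputable def lineOrder {d : ℕ} (f : Cn d → ℝ) (v : Cn d) : ℕ∞ :=
  vanishingOrder (fun ζ : ℂ => f (ζ • v))

/-- `V_r = {v ∈ ℂᵈ : ord(f; v) ≥ r}`. For a smooth, convex, nonnegative `f` with `f 0 = 0` this set
already is a complex linear subspace, so that taking its span changes nothing. -/
noncomputable def orderSubspace {d : ℕ} (f : Cn d → ℝ) (r : ℕ∞) : Submodule ℂ (Cn d) :=
  Submodule.span ℂ {v : Cn d | r ≤ lineOrder f v}

/-- The type `(m₁ ≤ … ≤ m_d)` of `f` at `0`, that is, the nondecreasing tuple in which each jump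
value `rᵢ` of the decreasing filtration `V_r` occurs `dim V_{rᵢ} - dim V_{rᵢ₊₁}` times (with
`V_{r_{k+1}} = 0` after the last jump value `r_k`). The `j`-th entry (counting from `j = 0`) is thus
the largest `r ∈ ℕ ∪ {∞}` with `dim V_r ≥ d - j`. -/
noncomputable def typeAtZero {d : ℕ} (f : Cn d → ℝ) : Fin d → ℕ∞ :=
  fun j => sSup {r : ℕ∞ | d ≤ Module.finrank ℂ (orderSubspace f r) + (j : ℕ)}

/-- The point `(w, z)` of `ℂ × ℂᵈ = ℂᵈ⁺¹`. -/
noncomputable def consPoint {d : ℕ} (w : ℂ) (z : Cn d) : Cn (d + 1) :=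
  WithLp.toLp 2 (Fin.cons w (fun i => z i) : Fin (d + 1) → ℂ)

/-- `F` is a local graph function, after the affine change of coordinates `T`, of the convex domain
`Ω` at its boundary point `ξ`: `T ξ = 0`, the image `T Ω` lies in `{Im z₀ > 0}` (so that, the
boundary being smooth, its tangent space at `0` is `ℝ × ℂᵈ`), and there are open neighbourhoods
`U`, `V`, `W` of the origins of `ℝ`, `ℝ`, `ℂᵈ` such that `F : U × W → V` is `C^∞` and
`T Ω ∩ ((U + iV) × W) = {(x + iy, z) ∈ (U + iV) × W : y > F (x, z)}`. -/
def IsLocalGraph {d : ℕ} (Ω : Set (Cn (d + 1))) (ξ : Cn (d + 1))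
    (T : Cn (d + 1) ≃ᵃ[ℂ] Cn (d + 1)) (F : ℝ × Cn d → ℝ) : Prop :=
  T ξ = 0 ∧ (∀ w ∈ T '' Ω, 0 < (w 0).im) ∧
    ∃ (U V : Set ℝ) (W : Set (Cn d)), IsOpen U ∧ 0 ∈ U ∧ IsOpen V ∧ 0 ∈ V ∧ IsOpen W ∧ 0 ∈ W ∧
      ContDiffOn ℝ ∞ F (U ×ˢ W) ∧ Set.MapsTo F (U ×ˢ W) V ∧
      ∀ x ∈ U, ∀ y ∈ V, ∀ z ∈ W,
        consPoint ((x : ℂ) + (y : ℂ) * Complex.I) z ∈ T '' Ω ↔ F (x, z) < y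

/-- `m` is the line type of the boundary point `ξ` of `Ω`: the type at `0` of the restriction
`z ↦ F (0, z)` of a local graph function `F` of `Ω` at `ξ`. (The tuple does not depend on the
choice of the affine coordinates.) -/
def IsLineType {d : ℕ} (Ω : Set (Cn (d + 1))) (ξ : Cn (d + 1)) (m : Fin d → ℕ∞) : Prop :=
  ∃ (T : Cn (d + 1) ≃ᵃ[ℂ] Cn (d + 1)) (F : ℝ × Cn d → ℝ),
    IsLocalGraph Ω ξ T F ∧ m = typeAtZero (fun z => F (0, z))

/-! ### Disks and planes -/

/-- The disk `𝔻 eᵢ`, where `𝔻` is the open unit disk of `ℂ`. -/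
def axisDisk {n : ℕ} (i : Fin n) : Set (Cn n) :=
  {w | ∃ ζ : ℂ, ‖ζ‖ < 1 ∧ w = ζ • stdVec i}

/-- The complex affine plane `Zᵢ = eᵢ + span {eⱼ : j > i}`. -/
def axisPlane {n : ℕ} (i : Fin n) : Set (Cn n) :=
  {w | ∃ z : Fin n → ℂ, w = stdVec i + ∑ j ∈ Finset.Ioi i, z j • stdVec j}

/-! In graph coordinates at `ξ`, the domain is rescaled about points `(iy, 0)` with `y` small. The
first new axis runs from `(iy, 0)` to the boundary point `0`, the second along a tangent direction
`v` of high order of contact, scaled to reach the boundary; the other axes come from repeatedly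
cutting with complex hyperplanes that miss the domain. The image contains all `𝔻 eᵢ` and misses all
`Zᵢ`.

Let `D(y)` be the radius of the largest disc about `(iy, 0)` in direction `v`. In the new
coordinates `(1 - ε) e₀` is the point `(iεy, 0)`, so the domain contains a disc of radius `D(εy) /
D(y)` about it in direction `e₁`. Contact of order `N` gives `y ≤ C D(y) ^ N`
(`exists_pow_lower_bound`). If `(1 - ε) ^ N < ε`, then `D` cannot lose more than a factor `1 - ε` at
every step `y ↦ εy`, so some arbitrarily small `y` has `D(εy) ≥ (1 - ε) D(y)`
(`exists_mul_le_of_pow_lower_bound`, `exists_normalization`). Infinite type enters only through the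
existence, for every finite `N`, of such a `v`, which may depend on `N`.

Finally let `ε → 0`. Gauges of normalized domains are Lipschitz with a constant depending only on
the dimension, so a subsequence converges (`exists_subseq_tendsto_isNormalized`). The closure of the
limit contains `e₀ + 𝔻 e₁`, while `Z₀`, which contains this disc, misses the limit; hence the disc
lies in the boundary. -/

/-- Open convex sets containing the discs `𝔻 eᵢ` and disjoint from the planes `Zᵢ`. -/
structure IsNormalized {n : ℕ} (S : Set (Cn n)) : Prop where
  isOpen : IsOpen S
  convex : Convex ℝ S
  zero_mem : (0 : Cn n) ∈ S
  axisDisk_subset : ∀ i, axisDisk i ⊆ S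
  axisPlane_inter : ∀ i, axisPlane i ∩ S = ∅

/-! ### Gauges of normalized domains. -/

namespace IsNormalized

variable {n : ℕ} {S : Set (Cn n)}

lemma mem_nhds (h : IsNormalized S) : S ∈ nhds (0 : Cn n) := h.isOpen.mem_nhds h.zero_mem

lemma absorbent (h : IsNormalized S) : Absorbent ℝ S := absorbent_nhds_zero h.mem_nhds

lemma gauge_smul_stdVec_le (h : IsNormalized S) (i : Fin n) (ζ : ℂ) :
    gauge S (ζ • stdVec i) ≤ ‖ζ‖ := by
  refine le_of_forall_gt_imp_ge_of_dense fun t ht => ?_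
  have ht0 : 0 < t := (norm_nonneg ζ).trans_lt ht
  refine gauge_le_of_mem ht0.le ?_
  refine ⟨((t : ℂ)⁻¹ * ζ) • stdVec i, h.axisDisk_subset i ⟨_, ?_, rfl⟩, ?_⟩
  · rw [norm_mul, norm_inv, Complex.norm_real, Real.norm_of_nonneg ht0.le, inv_mul_lt_one₀ ht0]
    exact ht
  · have : (t : ℂ) ≠ 0 := by exact_mod_cast ht0.ne'
    change t • (((t : ℂ)⁻¹ * ζ) • stdVec i) = _
    rw [← Complex.coe_smul, smul_smul, mul_inv_cancel_left₀ this]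

lemma eq_sum_stdVec (z : Cn n) : z = ∑ i, z i • stdVec i := by
  ext j
  simp [stdVec, Finset.sum_apply, Pi.single_apply]

lemma gauge_le (h : IsNormalized S) (z : Cn n) : gauge S z ≤ n * ‖z‖ := by
  conv_lhs => rw [eq_sum_stdVec z]
  calc _ ≤ ∑ i, gauge S (z i • stdVec i) := gauge_sum_le h.convex h.absorbent _ _
    _ ≤ ∑ _i : Fin n, ‖z‖ := Finset.sum_le_sum fun i _ =>
        (h.gauge_smul_stdVec_le i (z i)).trans (PiLp.norm_apply_le z i)
    _ = n * ‖z‖ := by simp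

lemma lipschitzWith_gauge (h : IsNormalized S) : LipschitzWith n (gauge S) := by
  refine LipschitzWith.of_le_add_mul _ fun x y => ?_
  have := gauge_add_le h.convex h.absorbent y (x - y)
  rw [add_sub_cancel] at this
  refine this.trans ?_
  gcongr
  rw [dist_eq_norm]
  simpa using h.gauge_le (x - y)

lemma one_le_gauge_of_mem_axisPlane (h : IsNormalized S) {i : Fin n} {z : Cn n}
    (hz : z ∈ axisPlane i) : 1 ≤ gauge S z := by
  by_contra! hlt
  have : z ∈ S := setOfPred_gauge_lt_one_subset_self h.convex h.zero_mem h.absorbent hlt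
  exact Set.eq_empty_iff_forall_notMem.1 (h.axisPlane_inter i) z ⟨hz, this⟩

/-- Divide by the first nonzero coordinate. Thus the planes `Zᵢ` together obstruct every complex
direction, which is what rules out complex lines in a normalized domain. -/
lemma exists_smul_mem_axisPlane {a : Cn n} (ha : a ≠ 0) :
    ∃ (i : Fin n) (ζ : ℂ), ζ • a ∈ axisPlane i := by
  classical
  have hne : (Finset.univ.filter fun i => a i ≠ 0).Nonempty := by
    by_contra hc
    rw [Finset.not_nonempty_iff_eq_empty] at hc
    apply ha
    ext i
    by_contra hi
    have : i ∈ Finset.univ.filter fun i => a i ≠ 0 := by simpa using hi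
    simp [hc] at this
  set i := Finset.min' _ hne with hi
  have hai : a i ≠ 0 := by simpa using Finset.min'_mem _ hne
  have hlt : ∀ j < i, a j = 0 := by
    intro j hj
    by_contra hc
    have := Finset.min'_le _ j (by simpa using hc : j ∈ Finset.univ.filter fun i => a i ≠ 0)
    exact absurd hj (not_lt.2 this)
  refine ⟨i, (a i)⁻¹, fun j => (a i)⁻¹ * a j, ?_⟩
  ext k
  have hk : (∑ j ∈ Finset.Ioi i, ((a i)⁻¹ * a j) • (stdVec j : Cn n)) k
      = if i < k then (a i)⁻¹ * a k else 0 := by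
    simp [stdVec, Pi.single_apply]
  rw [PiLp.add_apply, hk]
  rcases lt_trichotomy k i with h | h | h
  · simp [stdVec, hlt k h, h.ne, h.not_gt]
  · subst h
    simp [stdVec, hai]
  · simp [stdVec, h, h.ne']

lemma mem_pointedConvexDomains (h : IsNormalized S) : (S, (0 : Cn n)) ∈ PointedConvexDomains n := by
  refine ⟨⟨h.isOpen, ⟨0, h.zero_mem⟩, h.convex, fun a b ha hline => ?_⟩, h.zero_mem⟩
  obtain ⟨i, ζ, hζ⟩ := exists_smul_mem_axisPlane ha
  have h1 := h.one_le_gauge_of_mem_axisPlane hζ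
  obtain ⟨t, ht⟩ := exists_gt (1 + gauge S (-b))
  -- The gauge is at most `1` along the line but at least `t` at `t • ζ • a`; subadditivity then
  -- forces `t ≤ 1 + gauge S (-b)`.
  have ht0 : 0 < t := by linarith [gauge_nonneg (s := S) (-b)]
  have h2 : gauge S (b + ((t : ℂ) * ζ) • a) ≤ 1 := gauge_le_one_of_mem (hline _)
  have h3 := gauge_add_le h.convex h.absorbent (b + ((t : ℂ) * ζ) • a) (-b)
  have h4 : b + ((t : ℂ) * ζ) • a + -b = t • (ζ • a) := by
    rw [mul_smul, Complex.coe_smul]; abel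
  rw [h4, gauge_smul_of_nonneg ht0.le, smul_eq_mul] at h3
  nlinarith

end IsNormalized

/-! ### Compactness of the space of normalized domains. -/

/-- Closeness of two gauge-like functions forces closeness of their unit sublevel sets. -/
lemma exists_mem_sublevel_near {E : Type*} [NormedAddCommGroup E] [NormedSpace ℝ E]
    {a b : E → ℝ} {ε R : ℝ} (hε : 0 ≤ ε) (hR : 0 ≤ R)
    (hb : ∀ t : ℝ, 0 ≤ t → ∀ z, b (t • z) = t * b z)
    (hab : ∀ z, |a z - b z| ≤ ε * ‖z‖) {z : E} (hz : a z ≤ 1) (hzR : ‖z‖ ≤ R) :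
    ∃ y, b y ≤ 1 ∧ ‖y‖ ≤ R ∧ dist z y ≤ ε * R * R := by
  have hs : 0 < 1 + ε * R := by positivity
  have hbz : b z ≤ 1 + ε * R := by
    have h1 := (abs_le.1 (hab z)).1
    have h2 : ε * ‖z‖ ≤ ε * R := by gcongr
    linarith
  have hinv : (1 + ε * R)⁻¹ ≤ 1 := inv_le_one_of_one_le₀ (by nlinarith [mul_nonneg hε hR])
  -- Since `b z ≤ a z + ε * ‖z‖ ≤ 1 + ε * R`, a radial contraction by this factor suffices, and it
  -- does not leave the ball.
  refine ⟨(1 + ε * R)⁻¹ • z, ?_, ?_, ?_⟩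
  · rw [hb _ (by positivity), inv_mul_le_one₀ hs]
    exact hbz
  · rw [norm_smul, Real.norm_of_nonneg (by positivity)]
    nlinarith [norm_nonneg z]
  · have : z - (1 + ε * R)⁻¹ • z = (ε * R * (1 + ε * R)⁻¹) • z := by
      rw [eq_comm, sub_eq_add_neg, ← neg_smul]
      nth_rw 2 [← one_smul ℝ z]
      rw [← add_smul]
      congr 1
      field_simp
      ring
    rw [dist_eq_norm, this, norm_smul, Real.norm_of_nonneg (by positivity)]
    have h0 : 0 ≤ ε * R := mul_nonneg hε hR
    calc ε * R * (1 + ε * R)⁻¹ * ‖z‖ ≤ ε * R * 1 * R := by gcongr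
      _ = _ := by ring

/-- Arzelà–Ascoli on the closed unit ball, then extension by positive homogeneity; this turns the
uniform error into one proportional to `‖z‖`. -/
lemma exists_subseq_gauge_tendsto {n : ℕ} {S : ℕ → Set (Cn n)} (hS : ∀ k, IsNormalized (S k)) :
    ∃ (φ : ℕ → ℕ) (g : Cn n → ℝ) (ε : ℕ → ℝ), StrictMono φ ∧
      Filter.Tendsto ε Filter.atTop (nhds 0) ∧ (∀ k, 0 ≤ ε k) ∧
      ∀ k z, |gauge (S (φ k)) z - g z| ≤ ε k * ‖z‖ := by
  let B : Set (Cn n) := Metric.closedBall 0 1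
  let G : ℕ → BoundedContinuousFunction B ℝ := fun k => BoundedContinuousFunction.mkOfCompact
    ⟨fun z => gauge (S k) z, (hS k).lipschitzWith_gauge.continuous.comp continuous_subtype_val⟩
  have hlip : ∀ k, LipschitzWith n (G k) := fun k =>
    (mul_one (n : NNReal)) ▸ (hS k).lipschitzWith_gauge.comp (LipschitzWith.subtype_val B)
  have hcpt : IsCompact (closure (Set.range G)) := by
    refine BoundedContinuousFunction.arzela_ascoli (Set.Icc 0 (n : ℝ)) isCompact_Icc _ ?_ ?_
    · rintro _ x ⟨k, rfl⟩
      refine ⟨gauge_nonneg _, ((hS k).gauge_le x).trans ?_⟩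
      have : ‖(x : Cn n)‖ ≤ 1 := mem_closedBall_zero_iff.1 x.2
      exact mul_le_of_le_one_right (by positivity) this
    · refine (LipschitzWith.uniformEquicontinuous _ n ?_).equicontinuous
      rintro ⟨_, k, rfl⟩
      exact hlip k
  obtain ⟨h, -, φ, hφ, hlim⟩ := hcpt.tendsto_subseq (fun k => subset_closure ⟨k, rfl⟩)
  have hmem : ∀ z : Cn n, ‖z‖⁻¹ • z ∈ B := by
    intro z
    have : ‖‖z‖⁻¹ • z‖ ≤ 1 := by
      rw [norm_smul, norm_inv, norm_norm]
      exact inv_mul_le_one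
    simpa [B] using this
  refine ⟨φ, fun z => ‖z‖ * h ⟨_, hmem z⟩, fun k => dist (G (φ k)) h, hφ,
    tendsto_iff_dist_tendsto_zero.1 hlim, fun k => dist_nonneg, fun k z => ?_⟩
  have hz : gauge (S (φ k)) z = ‖z‖ * G (φ k) ⟨_, hmem z⟩ := by
    change _ = ‖z‖ * gauge (S (φ k)) (‖z‖⁻¹ • z)
    rw [← smul_eq_mul, ← gauge_smul_of_nonneg (norm_nonneg z), smul_smul]
    rcases eq_or_ne z 0 with rfl | hz
    · simp
    · rw [mul_inv_cancel₀ (norm_ne_zero_iff.2 hz), one_smul]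
  rw [hz, ← mul_sub, abs_mul, abs_norm, mul_comm]
  gcongr
  exact BoundedContinuousFunction.dist_coe_le_dist (f := G (φ k)) (g := h) _

/-- Compactness of the set of normalized domains, together with the stability under limits of a
disc in the boundary. -/
theorem exists_subseq_tendsto_isNormalized {d : ℕ} (hd : 0 < d) {S : ℕ → Set (Cn (d + 1))}
    (hS : ∀ k, IsNormalized (S k))
    (hdisk : ∀ k : ℕ, ∀ ζ : ℂ, ‖ζ‖ < 1 - 1 / ((k : ℝ) + 2) →
      (1 - 1 / ((k : ℝ) + 2)) • (stdVec 0 : Cn (d + 1)) + ζ • stdVec 1 ∈ S k) :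
    ∃ (φ : ℕ → ℕ) (S' : Set (Cn (d + 1))), StrictMono φ ∧
      PointedTendsto (fun k => (S (φ k), 0)) (S', 0) ∧ IsNormalized S' ∧
      (fun w => stdVec 0 + w) '' axisDisk (1 : Fin (d + 1)) ⊆ frontier S' := by
  obtain ⟨φ, g, ε, hφ, hε, hε0, hg⟩ := exists_subseq_gauge_tendsto hS
  have hlim : ∀ z, Filter.Tendsto (fun k => gauge (S (φ k)) z) Filter.atTop (nhds (g z)) := by
    intro z
    rw [tendsto_iff_dist_tendsto_zero]
    refine squeeze_zero (fun _ => dist_nonneg) (fun k => hg k z) ?_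
    simpa using hε.mul_const ‖z‖
  have hsmul : ∀ t : ℝ, 0 ≤ t → ∀ z, g (t • z) = t * g z := fun t ht z =>
    tendsto_nhds_unique (hlim _) (by
      simpa only [gauge_smul_of_nonneg ht, smul_eq_mul] using (hlim z).const_mul t)
  have hadd : ∀ y z, g (y + z) ≤ g y + g z := fun y z =>
    le_of_tendsto_of_tendsto' (hlim _) ((hlim y).add (hlim z))
      fun k => gauge_add_le (hS _).convex (hS _).absorbent _ _
  have hlip : LipschitzWith (d + 1 : ℕ) g := by
    refine LipschitzWith.of_dist_le_mul fun y z => ?_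
    exact le_of_tendsto' ((hlim y).dist (hlim z))
      fun k => (hS (φ k)).lipschitzWith_gauge.dist_le_mul y z
  have hg0 : g 0 = 0 := by simpa using hsmul 0 le_rfl 0
  set S' : Set (Cn (d + 1)) := {z | g z < 1} with hS'
  have hclosure : closure S' = {z | g z ≤ 1} := by
    refine subset_antisymm (closure_minimal (fun z (hz : g z < 1) => show g z ≤ 1 from hz.le)
      (isClosed_le hlip.continuous continuous_const)) fun z hz => ?_
    have ht : Filter.Tendsto (fun k : ℕ => (1 - 1 / ((k : ℝ) + 1)) • z) Filter.atTop (nhds z) := by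
      simpa using ((tendsto_const_nhds (x := (1 : ℝ))).sub
        (tendsto_one_div_add_atTop_nhds_zero_nat (𝕜 := ℝ))).smul_const z
    refine mem_closure_of_tendsto ht (Filter.Eventually.of_forall fun k => ?_)
    have h1 : (1 : ℝ) / ((k : ℝ) + 1) ≤ 1 := by
      rw [div_le_one (by positivity)]; linarith [k.cast_nonneg (α := ℝ)]
    have h2 : (0 : ℝ) < 1 / ((k : ℝ) + 1) := by positivity
    change g _ < 1
    have hz1 : g z ≤ 1 := hz
    rw [hsmul _ (by linarith)]
    nlinarith
  have hnorm : IsNormalized S' := by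
    refine ⟨isOpen_lt hlip.continuous continuous_const, ?_, ?_, ?_, ?_⟩
    · intro y hy z hz a b ha hb hab
      have hy' : g y < 1 := hy
      have hz' : g z < 1 := hz
      change g _ < 1
      have := hadd (a • y) (b • z)
      rw [hsmul a ha, hsmul b hb] at this
      rcases ha.eq_or_lt with rfl | ha
      · nlinarith
      · nlinarith
    · change g 0 < 1
      rw [hg0]; exact one_pos
    · rintro i _ ⟨ζ, hζ, rfl⟩
      exact (le_of_tendsto' (hlim _) fun k => (hS (φ k)).gauge_smul_stdVec_le i ζ).trans_lt hζ
    · intro i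
      refine Set.eq_empty_of_forall_notMem fun z hz => ?_
      have h1 : 1 ≤ g z :=
        ge_of_tendsto' (hlim z) fun k => (hS (φ k)).one_le_gauge_of_mem_axisPlane hz.1
      exact absurd hz.2 (not_lt.2 h1)
  refine ⟨φ, S', hφ, ⟨fun k => (hS _).mem_pointedConvexDomains, hnorm.mem_pointedConvexDomains,
    ⟨0, le_rfl, fun R hR => ?_⟩, tendsto_const_nhds⟩, hnorm, ?_⟩
  · have hbound : ∀ k, localHausdorffEDist R (closure (S (φ k))) (closure S') ≤
        ENNReal.ofReal (ε k * R * R) := by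
      intro k
      have hcl : closure (S (φ k)) = {z | gauge (S (φ k)) z ≤ 1} := by
        ext z
        exact (gauge_le_one_iff_mem_closure (hS _).convex (hS _).mem_nhds).symm
      rw [localHausdorffEDist, hclosure, hcl]
      refine Metric.hausdorffEDist_le_of_mem_edist ?_ ?_
      · rintro z ⟨hz, hzR⟩
        obtain ⟨y, h1, h2, h3⟩ := exists_mem_sublevel_near (hε0 k) hR hsmul (hg k) hz
          (by simpa using hzR)
        refine ⟨y, ⟨h1, by simpa using h2⟩, ?_⟩
        rw [edist_dist]
        exact ENNReal.ofReal_le_ofReal h3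
      · rintro z ⟨hz, hzR⟩
        obtain ⟨y, h1, h2, h3⟩ := exists_mem_sublevel_near (hε0 k) hR
          (b := gauge (S (φ k))) (fun t ht z => by rw [gauge_smul_of_nonneg ht, smul_eq_mul])
          (fun z => by rw [abs_sub_comm]; exact hg k z) hz (by simpa using hzR)
        refine ⟨y, ⟨h1, by simpa using h2⟩, ?_⟩
        rw [edist_dist]
        exact ENNReal.ofReal_le_ofReal h3
    refine tendsto_of_tendsto_of_tendsto_of_le_of_le tendsto_const_nhds ?_
      (fun _ => bot_le) hbound
    have := (hε.mul_const R).mul_const R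
    simpa using ENNReal.tendsto_ofReal this
  · rintro _ ⟨_, ⟨ζ, hζ, rfl⟩, rfl⟩
    rw [hnorm.isOpen.frontier_eq]
    have hδ : Filter.Tendsto (fun k : ℕ => 1 / ((φ k : ℝ) + 2)) Filter.atTop (nhds 0) := by
      have h0 : Filter.Tendsto (fun k : ℕ => 1 / ((k : ℝ) + 2)) Filter.atTop (nhds 0) := by
        have := (Filter.tendsto_add_atTop_iff_nat 1).2
          (tendsto_one_div_add_atTop_nhds_zero_nat (𝕜 := ℝ))
        refine this.congr fun k => ?_
        push_cast; ring
      exact h0.comp hφ.tendsto_atTop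
    constructor
    · rw [hclosure]
      change g _ ≤ 1
      have hb : Filter.Tendsto (fun k : ℕ => 1 + 1 / ((φ k : ℝ) + 2) *
          gauge (S (φ k)) (stdVec 0)) Filter.atTop (nhds 1) := by
        simpa using tendsto_const_nhds (x := (1 : ℝ)) |>.add (hδ.mul (hlim (stdVec 0)))
      refine le_of_tendsto_of_tendsto (hlim _) hb ?_
      -- With `δ = 1 / (φ k + 2)`, once `δ < 1 - ‖ζ‖` the point `(1 - δ) e₀ + ζ e₁` is in the
      -- domain; adding back `δ e₀` raises the gauge by at most `δ * gauge e₀`.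
      have hev : ∀ᶠ k in Filter.atTop, 1 / ((φ k : ℝ) + 2) < 1 - ‖ζ‖ :=
        hδ.eventually_lt_const (by linarith)
      filter_upwards [hev] with k hk
      have h1 := gauge_le_one_of_mem (hdisk (φ k) ζ (by linarith))
      have h2 := gauge_add_le (hS (φ k)).convex (hS (φ k)).absorbent
        ((1 - 1 / ((φ k : ℝ) + 2)) • (stdVec 0 : Cn (d + 1)) + ζ • stdVec 1)
        ((1 / ((φ k : ℝ) + 2)) • stdVec 0)
      rw [gauge_smul_of_nonneg (by positivity), smul_eq_mul] at h2
      have h3 : (1 - 1 / ((φ k : ℝ) + 2)) • (stdVec 0 : Cn (d + 1)) + ζ • stdVec 1 +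
          (1 / ((φ k : ℝ) + 2)) • stdVec 0 = stdVec 0 + ζ • stdVec 1 := by
        rw [sub_smul, one_smul]; abel
      rw [h3] at h2
      linarith
    · refine fun hmem => Set.eq_empty_iff_forall_notMem.1 (hnorm.axisPlane_inter 0) _ ⟨?_, hmem⟩
      refine ⟨Pi.single 1 ζ, ?_⟩
      rw [Finset.sum_eq_single_of_mem 1 (by simpa using hd.ne')
        fun j _ hj => by rw [Pi.single_eq_of_ne hj, zero_smul], Pi.single_eq_same]

/-! ### Frames adapted to a bounded convex domain. -/

section AdaptedFrame

variable {E : Type*} [NormedAddCommGroup E] [NormedSpace ℂ E]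

/-- The radius, measured in multiples of `v`, of the largest complex disc in the direction `v`
about `x` which is contained in `G`. -/
noncomputable def discRadius (G : Set E) (x v : E) : ℝ :=
  Metric.infDist (0 : ℂ) {ζ : ℂ | x + ζ • v ∉ G}

lemma add_smul_mem_of_norm_lt_discRadius {G : Set E} {x v : E} {ζ : ℂ}
    (hζ : ‖ζ‖ < discRadius G x v) : x + ζ • v ∈ G := by
  by_contra hc
  refine Metric.notMem_of_dist_lt_infDist (x := (0 : ℂ)) (y := ζ) ?_
    (show ζ ∈ {ζ : ℂ | x + ζ • v ∉ G} from hc)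
  rwa [dist_zero_left]

lemma exists_norm_eq_discRadius {G : Set E} (hG : IsOpen G) (hb : Bornology.IsBounded G) {x v : E}
    (hv : v ≠ 0) : ∃ ζ : ℂ, x + ζ • v ∉ G ∧ ‖ζ‖ = discRadius G x v := by
  have hclosed : IsClosed {ζ : ℂ | x + ζ • v ∉ G} := by
    have : IsOpen ((fun ζ : ℂ => x + ζ • v) ⁻¹' G) := hG.preimage (by fun_prop)
    exact this.isClosed_compl
  have hne : {ζ : ℂ | x + ζ • v ∉ G}.Nonempty := by
    obtain ⟨R, hR⟩ := hb.exists_norm_le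
    by_contra hc
    have hall : ∀ ζ : ℂ, x + ζ • v ∈ G := by
      intro ζ
      by_contra h
      exact hc ⟨ζ, h⟩
    have hv0 : 0 < ‖v‖ := norm_pos_iff.2 hv
    have hx : ‖x‖ ≤ R := by simpa using hR _ (hall 0)
    have h1 := hR _ (hall (((2 * R + 1) / ‖v‖ : ℝ) : ℂ))
    have h2 : ‖(((2 * R + 1) / ‖v‖ : ℝ) : ℂ) • v‖ = 2 * R + 1 := by
      rw [norm_smul, Complex.norm_real, Real.norm_of_nonneg, div_mul_cancel₀ _ hv0.ne']
      exact div_nonneg (by linarith [norm_nonneg x]) hv0.le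
    have h3 := norm_sub_le (x + (((2 * R + 1) / ‖v‖ : ℝ) : ℂ) • v) x
    rw [add_sub_cancel_left, h2] at h3
    linarith
  obtain ⟨ζ, hζ, h⟩ := hclosed.exists_infDist_eq_dist hne 0
  exact ⟨ζ, hζ, by rw [discRadius, h, dist_zero_left]⟩

lemma exists_normalized_smul {G : Set E} (hG : IsOpen G) (hb : Bornology.IsBounded G) {x v : E}
    (hx : x ∈ G) (hv : v ≠ 0) : ∃ ζ : ℂ, ‖ζ‖ = discRadius G x v ∧ 0 < ‖ζ‖ ∧ x + ζ • v ∉ G ∧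
      ∀ z : ℂ, ‖z‖ < 1 → x + z • ζ • v ∈ G := by
  obtain ⟨ζ, hζ, h⟩ := exists_norm_eq_discRadius hG hb (x := x) hv
  have h0 : 0 < ‖ζ‖ := by
    rw [norm_pos_iff]
    rintro rfl
    simp [hx] at hζ
  refine ⟨ζ, h, h0, hζ, fun z hz => ?_⟩
  rw [smul_smul]
  refine add_smul_mem_of_norm_lt_discRadius ?_
  rw [norm_mul, ← h]
  exact mul_lt_of_lt_one_left h0 hz

/-- Linearly independent vectors `bᵢ` such that the discs `x + 𝔻 bᵢ` lie in `G` and the planes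
`x + bᵢ + span {bⱼ : j > i}` miss `G`. -/
structure IsAdaptedFrame (G : Set E) (x : E) {k : ℕ} (b : Fin k → E) : Prop where
  disc : ∀ i, ∀ ζ : ℂ, ‖ζ‖ < 1 → x + ζ • b i ∈ G
  plane : ∀ i, ∀ w ∈ Submodule.span ℂ (b '' Set.Ioi i), x + b i + w ∉ G
  linearIndependent : LinearIndependent ℂ b

lemma IsAdaptedFrame.cons {G : Set E} {x : E} {k : ℕ} {b : Fin k → E} (h : IsAdaptedFrame G x b)
    (hx : x ∈ G) {v : E} (hdisc : ∀ ζ : ℂ, ‖ζ‖ < 1 → x + ζ • v ∈ G) {W : Submodule ℂ E}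
    (hb : ∀ i, b i ∈ W) (hW : ∀ w ∈ W, x + v + w ∉ G) :
    IsAdaptedFrame G x (Fin.cons v b : Fin (k + 1) → E) := by
  refine ⟨fun i => ?_, fun i => ?_, ?_⟩
  · cases i using Fin.cases with
    | zero => simpa using hdisc
    | succ i => simpa using h.disc i
  · cases i using Fin.cases with
    | zero =>
      intro w hw
      refine hW w ((Submodule.span_le.2 ?_) hw)
      rintro _ ⟨j, hj, rfl⟩
      obtain ⟨j, rfl⟩ := Fin.exists_succ_eq.2 (ne_of_gt hj)
      exact hb j
    | succ i =>
      intro w hw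
      refine h.plane i w ((Submodule.span_mono ?_) hw)
      rintro _ ⟨j, hj, rfl⟩
      obtain ⟨j, rfl⟩ := Fin.exists_succ_eq.2 (ne_of_gt ((Fin.succ_pos i).trans hj))
      exact ⟨j, Fin.succ_lt_succ_iff.1 hj, rfl⟩
  · refine linearIndependent_finCons.2 ⟨h.linearIndependent, fun hv => ?_⟩
    -- If `v` lay in `W`, then `x = x + v + (-v)` would be in the plane that misses `G`.
    have hvW : v ∈ W := (Submodule.span_le.2 (Set.range_subset_iff.2 hb)) hv
    refine hW (-v) (W.neg_mem hvW) ?_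
    simpa using hx

/-- The real part of a complex functional already separates strictly, so its whole complex level set
through `p` avoids `G`. -/
lemma exists_complex_hyperplane {G : Set E} (hG : IsOpen G) (hc : Convex ℝ G) {p : E}
    (hp : p ∉ G) : ∃ l : E →ₗ[ℂ] ℂ, ∀ z ∈ G, l z ≠ l p := by
  obtain ⟨f, hf⟩ := RCLike.geometric_hahn_banach_open_point (𝕜 := ℂ) hc hG hp
  refine ⟨f, fun z hz h => (hf z hz).ne ?_⟩
  exact congrArg RCLike.re h

lemma finrank_inf_ker_add_one [FiniteDimensional ℂ E] {W : Submodule ℂ E} {l : E →ₗ[ℂ] ℂ} {v : E}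
    (hv : v ∈ W) (hl : l v ≠ 0) :
    Module.finrank ℂ (W ⊓ LinearMap.ker l : Submodule ℂ E) + 1 = Module.finrank ℂ W := by
  have hsurj : LinearMap.range (l.domRestrict W) = ⊤ := by
    refine LinearMap.range_eq_top.2 fun c => ⟨(c / l v) • ⟨v, hv⟩, ?_⟩
    simp [hl]
  have h := LinearMap.finrank_range_add_finrank_ker (l.domRestrict W)
  rw [hsurj, finrank_top, Module.finrank_self] at h
  have hker : LinearMap.ker (l.domRestrict W) = (LinearMap.ker l).comap W.subtype := rfl
  have h2 : Module.finrank ℂ (W ⊓ LinearMap.ker l : Submodule ℂ E) =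
      Module.finrank ℂ (LinearMap.ker (l.domRestrict W)) := by
    rw [hker, ← Submodule.map_comap_subtype]
    exact (Submodule.equivSubtypeMap W _).finrank_eq.symm
  rw [h2, ← h, add_comm]

/-- Extension of a frame by one vector whose tip lies outside `G`, the remaining vectors being
chosen in a smaller subspace. -/
lemma exists_isAdaptedFrame_step [FiniteDimensional ℂ E] {G : Set E} (hG : IsOpen G)
    (hc : Convex ℝ G) {x : E} (hx : x ∈ G) {k : ℕ} {W : Submodule ℂ E}
    (hW : Module.finrank ℂ W = k + 1) {v : E} (hv : v ∈ W)
    (hdisc : ∀ ζ : ℂ, ‖ζ‖ < 1 → x + ζ • v ∈ G) (hout : x + v ∉ G)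
    (ih : ∀ W' : Submodule ℂ E, Module.finrank ℂ W' = k →
      ∃ b : Fin k → E, IsAdaptedFrame G x b ∧ ∀ i, b i ∈ W') :
    ∃ b : Fin (k + 1) → E, IsAdaptedFrame G x b ∧ (∀ i, b i ∈ W) ∧ b 0 = v := by
  obtain ⟨l, hl⟩ := exists_complex_hyperplane hG hc hout
  have hlv : l v ≠ 0 := fun h0 => hl x hx (by rw [map_add, h0, add_zero])
  obtain ⟨b, hb, hbW⟩ := ih (W ⊓ LinearMap.ker l)
    (by have := finrank_inf_ker_add_one hv hlv; omega)
  refine ⟨Fin.cons v b, hb.cons hx hdisc (fun i => (hbW i).2) fun w hw hmem => ?_,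
    Fin.cases hv fun i => (hbW i).1, rfl⟩
  refine hl _ hmem ?_
  rw [map_add l (x + v), LinearMap.mem_ker.1 hw, add_zero]

lemma exists_isAdaptedFrame [FiniteDimensional ℂ E] {G : Set E} (hG : IsOpen G)
    (hc : Convex ℝ G) (hbd : Bornology.IsBounded G) {x : E} (hx : x ∈ G) (k : ℕ) :
    ∀ W : Submodule ℂ E, Module.finrank ℂ W = k →
      ∃ b : Fin k → E, IsAdaptedFrame G x b ∧ ∀ i, b i ∈ W := by
  induction k with
  | zero =>
    exact fun W _ => ⟨Fin.elim0, ⟨fun i => i.elim0, fun i => i.elim0, linearIndependent_empty_type⟩,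
      fun i => i.elim0⟩
  | succ k ih =>
    intro W hW
    obtain ⟨v, hv, hv0⟩ := W.exists_mem_ne_zero_of_ne_bot (by
      rintro rfl
      simp at hW)
    obtain ⟨ζ, -, -, hout, hdisc⟩ := exists_normalized_smul hG hbd hx hv0
    obtain ⟨b, hb, hbW, -⟩ := exists_isAdaptedFrame_step hG hc hx hW (W.smul_mem ζ hv)
      hdisc hout ih
    exact ⟨b, hb, hbW⟩

end AdaptedFrame

/-- The affine coordinates with origin `x` and axes given by an adapted frame turn `G` into a
normalized domain. -/
lemma IsAdaptedFrame.exists_affineEquiv {n : ℕ} {G : Set (Cn n)} (hG : IsOpen G)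
    (hc : Convex ℝ G) {x : Cn n} (hx : x ∈ G) {b : Fin n → Cn n} (h : IsAdaptedFrame G x b) :
    ∃ (B : Cn n ≃ᵃ[ℂ] Cn n) (L : Cn n →ₗ[ℂ] Cn n), (∀ w, B w = x + L w) ∧
      (∀ i, L (stdVec i) = b i) ∧ IsNormalized (B ⁻¹' G) := by
  have hcard : Fintype.card (Fin n) = Module.finrank ℂ (Cn n) := by simp
  let β : Module.Basis (Fin n) ℂ (Cn n) := basisOfLinearIndependentOfCardEqFinrank' b
    h.linearIndependent hcard
  let L : Cn n ≃ₗ[ℂ] Cn n := (WithLp.linearEquiv 2 ℂ (Fin n → ℂ)).trans β.equivFun.symm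
  have hL : ∀ w, L w = ∑ i, w i • b i := by
    intro w
    simp [L, β, Module.Basis.equivFun_symm_apply]
  let B : Cn n ≃ᵃ[ℂ] Cn n := L.toAffineEquiv.trans (AffineEquiv.constVAdd ℂ (Cn n) x)
  have hB : ∀ w, B w = x + L w := fun w => rfl
  have hLstd : ∀ i, L (stdVec i) = b i := by
    intro i
    rw [hL, Finset.sum_eq_single i] <;> simp +contextual [stdVec]
  have hcont : Continuous B := B.toAffineMap.continuous_of_finiteDimensional
  refine ⟨B, L, hB, hLstd, hG.preimage hcont, ?_, ?_, ?_, ?_⟩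
  · exact (hc.translate_preimage_right x).linear_preimage (L.toLinearMap.restrictScalars ℝ)
  · change B 0 ∈ G
    simpa [hB] using hx
  · rintro i _ ⟨ζ, hζ, rfl⟩
    change B _ ∈ G
    rw [hB, map_smul, hLstd]
    exact h.disc i ζ hζ
  · intro i
    refine Set.eq_empty_of_forall_notMem ?_
    rintro _ ⟨⟨z, rfl⟩, hmem⟩
    refine h.plane i (∑ j ∈ Finset.Ioi i, z j • b j) (Submodule.sum_mem _ fun j hj =>
      Submodule.smul_mem _ _ (Submodule.subset_span ⟨j, by simpa using hj, rfl⟩)) ?_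
    have hmem' : B (stdVec i + ∑ j ∈ Finset.Ioi i, z j • stdVec j) ∈ G := hmem
    rw [hB, map_add, map_sum, ← add_assoc, hLstd] at hmem'
    simpa only [map_smul, hLstd] using hmem'

/-! ### Order of vanishing and decay of disc radii. -/

/-- A smooth function whose derivatives of order less than `N` vanish at `0` is `O(‖x‖ ^ N)`. -/
lemma isBigO_norm_pow_of_iteratedFDeriv_eq_zero {E : Type} [NormedAddCommGroup E]
    [NormedSpace ℝ E] (N : ℕ) : ∀ {F : Type} [NormedAddCommGroup F] [NormedSpace ℝ F] {h : E → F},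
    ContDiffAt ℝ ∞ h 0 → (∀ k < N, iteratedFDeriv ℝ k h 0 = 0) →
      h =O[nhds 0] fun x => ‖x‖ ^ N := by
  induction N with
  | zero =>
    intro F _ _ h hh _
    simpa using hh.continuousAt.tendsto.isBigO_one ℝ
  | succ N ih =>
    intro F _ _ h hh hk
    have hh' : ContDiffAt ℝ ∞ (fderiv ℝ h) 0 := hh.fderiv_right (by simp)
    have hO := ih hh' fun k hkN => by
      have := hk (k + 1) (by omega)
      rw [← norm_eq_zero, norm_iteratedFDeriv_fderiv, this, norm_zero]
    obtain ⟨C, hC0, hC⟩ := hO.exists_nonneg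
    have hdiff : ∀ᶠ x in nhds (0 : E), DifferentiableAt ℝ h x := by
      have h1 : ContDiffAt ℝ 1 h 0 := hh.of_le (by simp)
      filter_upwards [h1.eventually (by simp)] with x hx
      exact hx.differentiableAt (by simp)
    have h00 : h 0 = 0 := by
      have := hk 0 (by omega)
      rw [← norm_eq_zero, norm_iteratedFDeriv_zero] at this
      exact norm_eq_zero.1 this
    obtain ⟨r, hr, hball⟩ := Metric.eventually_nhds_iff.1 (hdiff.and hC.bound)
    refine Asymptotics.IsBigO.of_bound C ?_
    filter_upwards [Metric.ball_mem_nhds (0 : E) hr] with x hx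
    rw [mem_ball_zero_iff] at hx
    have hlt : ∀ z ∈ Metric.closedBall (0 : E) ‖x‖, dist z 0 < r := fun z hz =>
      (Metric.mem_closedBall.1 hz).trans_lt hx
    -- The derivative is at most `C * ‖x‖ ^ N` on the ball of radius `‖x‖`, so the mean value
    -- inequality gains one power.
    have hmv := (convex_closedBall (0 : E) ‖x‖).norm_image_sub_le_of_norm_fderiv_le (𝕜 := ℝ)
      (f := h) (C := C * ‖x‖ ^ N) (x := 0) (y := x) (fun z hz => (hball (hlt z hz)).1)
      (fun z hz => (hball (hlt z hz)).2.trans (by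
        rw [norm_pow, norm_norm]
        gcongr
        simpa using hz)) (by simp) (by simp)
    rw [h00, sub_zero, sub_zero] at hmv
    rw [norm_pow, norm_norm, pow_succ, ← mul_assoc]
    exact hmv

lemma iteratedFDeriv_eq_zero_of_lt_vanishingOrder {g : ℂ → ℝ} {k : ℕ}
    (hk : (k : ℕ∞) < vanishingOrder g) : iteratedFDeriv ℝ k g 0 = 0 := by
  by_contra hc
  exact (sInf_le (show (k : ℕ∞) ∈ {r : ℕ∞ | ∃ k : ℕ, r = k ∧ iteratedFDeriv ℝ k g 0 ≠ 0} from
    ⟨k, rfl, hc⟩)).not_gt hk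

/-- The supremum need not be attained: some admissible `a > N` is enough, and its subspace is
nonzero because `j < d`. -/
lemma exists_le_lineOrder_of_typeAtZero_eq_top {d : ℕ} {f : Cn d → ℝ} {j : Fin d}
    (hj : typeAtZero f j = ⊤) (N : ℕ) : ∃ v : Cn d, v ≠ 0 ∧ (N : ℕ∞) ≤ lineOrder f v := by
  obtain ⟨a, ha, hNa⟩ := sSup_eq_top.1 hj N (ENat.natCast_lt_top N)
  have ha' : d ≤ Module.finrank ℂ (orderSubspace f a) + (j : ℕ) := ha
  by_contra! hc
  have hbot : orderSubspace f a = ⊥ := by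
    rw [orderSubspace, Submodule.span_eq_bot]
    intro v hv
    by_contra hv0
    exact ((hc v hv0).trans hNa).not_ge hv
  rw [hbot, finrank_bot] at ha'
  omega

/-- A function decaying at most like a power of `y` does not decay geometrically at a faster
rate. -/
lemma exists_mul_le_of_pow_lower_bound {D : ℝ → ℝ} (hD : ∀ y, 0 ≤ D y) {C r q ε : ℝ} {N : ℕ}
    (hC : 0 ≤ C) (hr : 0 < r) (hq : 0 < q) (hε : 0 < ε) (hε1 : ε ≤ 1) (hqε : q ^ N < ε)
    (hlow : ∀ y, 0 < y → y < r → y ≤ C * D y ^ N) :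
    ∃ y, 0 < y ∧ y < r ∧ q * D y ≤ D (ε * y) := by
  by_contra! hc
  set y₀ := r / 2 with hy₀
  have hy₀0 : 0 < y₀ := by positivity
  have hpos : ∀ k : ℕ, 0 < ε ^ k * y₀ := fun k => by positivity
  have hlt : ∀ k : ℕ, ε ^ k * y₀ < r := fun k => by
    have : ε ^ k ≤ 1 := pow_le_one₀ hε.le hε1
    nlinarith
  have hdec : ∀ k : ℕ, D (ε ^ k * y₀) ≤ q ^ k * D y₀ := by
    intro k
    induction k with
    | zero => simp
    | succ k ih =>
      have := hc _ (hpos k) (hlt k)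
      rw [pow_succ', mul_assoc]
      calc _ ≤ q * D (ε ^ k * y₀) := this.le
        _ ≤ q * (q ^ k * D y₀) := by gcongr
        _ = _ := by ring
  -- Inserting the geometric decay into the lower bound at `ε ^ k * y₀` leaves the ratio `q ^ N / ε
  -- < 1`, which forces `y₀ ≤ 0`.
  have hbound : ∀ k : ℕ, y₀ ≤ C * D y₀ ^ N * (q ^ N / ε) ^ k := by
    intro k
    have h1 := hlow _ (hpos k) (hlt k)
    have h2 : C * D (ε ^ k * y₀) ^ N ≤ C * (q ^ k * D y₀) ^ N := by
      have := hD (ε ^ k * y₀)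
      have := hdec k
      gcongr
    have h3 : C * D y₀ ^ N * (q ^ N / ε) ^ k = C * (q ^ k * D y₀) ^ N / ε ^ k := by
      rw [div_pow, mul_pow, ← pow_mul, ← pow_mul, mul_comm N k]
      ring
    rw [h3, le_div_iff₀ (by positivity), mul_comm]
    exact h1.trans h2
  have hlim : Filter.Tendsto (fun k : ℕ => C * D y₀ ^ N * (q ^ N / ε) ^ k) Filter.atTop
      (nhds 0) := by
    simpa using (tendsto_pow_atTop_nhds_zero_of_lt_one (by positivity)
      ((div_lt_one hε).2 hqε)).const_mul (C * D y₀ ^ N)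
  exact hy₀0.not_ge (ge_of_tendsto' hlim hbound)

/-! ### Coordinates and local graphs. -/

section ConsPoint

variable {d : ℕ}

@[simp] lemma consPoint_zero (w : ℂ) (z : Cn d) : consPoint w z 0 = w := rfl

@[simp] lemma consPoint_succ (w : ℂ) (z : Cn d) (i : Fin d) : consPoint w z i.succ = z i := rfl

lemma consPoint_add (w w' : ℂ) (z z' : Cn d) :
    consPoint w z + consPoint w' z' = consPoint (w + w') (z + z') := by
  ext i
  cases i using Fin.cases <;> simp

lemma smul_consPoint (c w : ℂ) (z : Cn d) : c • consPoint w z = consPoint (c * w) (c • z) := by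
  ext i
  cases i using Fin.cases <;> simp

lemma consPoint_zero_zero : consPoint 0 (0 : Cn d) = 0 := by
  ext i
  cases i using Fin.cases <;> simp

lemma consPoint_eq_self (w : Cn (d + 1)) :
    consPoint (w 0) (WithLp.toLp 2 fun i : Fin d => w i.succ) = w := by
  ext i
  cases i using Fin.cases <;> simp

lemma norm_consPoint_left (w : ℂ) : ‖consPoint w (0 : Cn d)‖ = ‖w‖ := by
  rw [EuclideanSpace.norm_eq, Fin.sum_univ_succ]
  simp

end ConsPoint

/-- `F` is a smooth graph function near `0` of the set `G`, which lies in the upper half space and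
has `0` as a boundary point. -/
structure IsGraphAtZero {d : ℕ} (G : Set (Cn (d + 1))) (F : ℝ × Cn d → ℝ) : Prop where
  im_pos : ∀ w ∈ G, 0 < (w 0).im
  zero_mem_closure : (0 : Cn (d + 1)) ∈ closure G
  contDiffAt : ContDiffAt ℝ ∞ F 0
  mem_iff : ∃ r : ℝ, 0 < r ∧ ∀ (x y : ℝ) (z : Cn d), |x| < r → |y| < r → ‖z‖ < r →
    (consPoint ((x : ℂ) + (y : ℂ) * Complex.I) z ∈ G ↔ F (x, z) < y)

lemma IsLocalGraph.isGraphAtZero {d : ℕ} {Ω : Set (Cn (d + 1))} {ξ : Cn (d + 1)}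
    {T : Cn (d + 1) ≃ᵃ[ℂ] Cn (d + 1)} {F : ℝ × Cn d → ℝ} (h : IsLocalGraph Ω ξ T F)
    (hξ : ξ ∈ closure Ω) : IsGraphAtZero (T '' Ω) F := by
  obtain ⟨hT, him, U, V, W, hU, hU0, hV, hV0, hW, hW0, hF, -, hgraph⟩ := h
  have hcont : Continuous T := T.toAffineMap.continuous_of_finiteDimensional
  refine ⟨him, ?_, ?_, ?_⟩
  · rw [← hT]
    exact image_closure_subset_closure_image hcont ⟨ξ, hξ, rfl⟩
  · exact hF.contDiffAt ((hU.prod hW).mem_nhds ⟨hU0, hW0⟩)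
  · obtain ⟨r₁, hr₁, h₁⟩ := Metric.isOpen_iff.1 hU 0 hU0
    obtain ⟨r₂, hr₂, h₂⟩ := Metric.isOpen_iff.1 hV 0 hV0
    obtain ⟨r₃, hr₃, h₃⟩ := Metric.isOpen_iff.1 hW 0 hW0
    refine ⟨min r₁ (min r₂ r₃), by positivity, fun x y z hx hy hz =>
      hgraph x (h₁ ?_) y (h₂ ?_) z (h₃ ?_)⟩
    · rw [mem_ball_zero_iff]
      exact hx.trans_le (min_le_left _ _)
    · rw [mem_ball_zero_iff]
      exact hy.trans_le ((min_le_right _ _).trans (min_le_left _ _))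
    · rw [mem_ball_zero_iff]
      exact hz.trans_le ((min_le_right _ _).trans (min_le_right _ _))

namespace IsGraphAtZero

variable {d : ℕ} {G : Set (Cn (d + 1))} {F : ℝ × Cn d → ℝ}

lemma eventually_nonneg (h : IsGraphAtZero G F) : ∀ᶠ p in nhds (0 : ℝ × Cn d), 0 ≤ F p := by
  obtain ⟨r, hr, hmem⟩ := h.mem_iff
  filter_upwards [Metric.ball_mem_nhds 0 hr] with p hp
  obtain ⟨x, z⟩ := p
  rw [mem_ball_zero_iff, Prod.norm_def, max_lt_iff] at hp
  by_contra! hneg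
  -- A negative height above the graph, truncated to stay in the window `|y| < r`.
  set y := max (F (x, z) / 2) (-(r / 2)) with hy
  have hy0 : y < 0 := max_lt (by linarith) (by linarith)
  have hyr : |y| < r := by
    rw [abs_of_neg hy0]
    linarith [le_max_right (F (x, z) / 2) (-(r / 2))]
  have hFy : F (x, z) < y := lt_of_lt_of_le (by linarith) (le_max_left _ _)
  have := h.im_pos _ ((hmem x y z hp.1 hyr hp.2).2 hFy)
  simp at this
  linarith

/-- If `F 0` were positive, points near `0` would lie below the graph, so `0` would not be in the
closure of `G`. -/
lemma apply_zero (h : IsGraphAtZero G F) : F 0 = 0 := by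
  refine le_antisymm ?_ h.eventually_nonneg.self_of_nhds
  by_contra! hpos
  obtain ⟨r, hr, hmem⟩ := h.mem_iff
  have hp : Continuous fun w : Cn (d + 1) =>
      (((w 0).re, WithLp.toLp 2 fun i : Fin d => w i.succ) : ℝ × Cn d) := by fun_prop
  have hp0 : (((((0 : Cn (d + 1)) 0).re, WithLp.toLp 2 fun i : Fin d => (0 : Cn (d + 1)) i.succ)) :
      ℝ × Cn d) = 0 := rfl
  have hy : Continuous fun w : Cn (d + 1) => (w 0).im := by fun_prop
  have h1 : ∀ᶠ w in nhds (0 : Cn (d + 1)),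
      (w 0).im < F ((w 0).re, WithLp.toLp 2 fun i : Fin d => w i.succ) := by
    refine hy.continuousAt.eventually_lt (ContinuousAt.comp (g := F) ?_ hp.continuousAt) ?_
    · rw [hp0]
      exact h.contDiffAt.continuousAt
    · rw [hp0]
      simpa using hpos
  have h2 : ∀ᶠ w in nhds (0 : Cn (d + 1)),
      (((w 0).re, WithLp.toLp 2 fun i : Fin d => w i.succ) : ℝ × Cn d) ∈ Metric.ball 0 r :=
    hp.continuousAt.eventually_mem (by rw [hp0]; exact Metric.ball_mem_nhds 0 hr)
  have h3 : ∀ᶠ w in nhds (0 : Cn (d + 1)), (w 0).im ∈ Metric.ball (0 : ℝ) r :=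
    hy.continuousAt.eventually_mem (by simpa using Metric.ball_mem_nhds (0 : ℝ) hr)
  obtain ⟨w, hwG, hw1, hw2, hw3⟩ :=
    ((mem_closure_iff_frequently.1 h.zero_mem_closure).and_eventually
      (h1.and (h2.and h3))).exists
  rw [mem_ball_zero_iff, Prod.norm_def, max_lt_iff] at hw2
  rw [mem_ball_zero_iff] at hw3
  have := (hmem (w 0).re (w 0).im _ hw2.1 hw3 hw2.2).1 (by
    rw [Complex.re_add_im, consPoint_eq_self]
    exact hwG)
  exact this.not_gt hw1

/-- The discs tangent to the boundary at `0` in the normal complex direction. -/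
lemma exists_disc_mem (h : IsGraphAtZero G F) : ∃ r : ℝ, 0 < r ∧ ∀ y : ℝ, 0 < y → y < r →
    ∀ ζ : ℂ, ‖ζ‖ < 1 → consPoint ((y : ℂ) * Complex.I * (1 - ζ)) 0 ∈ G := by
  obtain ⟨r, hr, hmem⟩ := h.mem_iff
  set a : ℝ → ℝ := fun x => F (x, 0) with ha
  have hcd : ContDiffAt ℝ ∞ a 0 := by
    refine ContDiffAt.comp (g := F) (f := fun x : ℝ => ((x, 0) : ℝ × Cn d)) 0 h.contDiffAt ?_
    exact contDiffAt_id.prodMk contDiffAt_const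
  have ha0 : a 0 = 0 := h.apply_zero
  have hmin : IsLocalMin a 0 := by
    have ht : Filter.Tendsto (fun x : ℝ => ((x, 0) : ℝ × Cn d)) (nhds 0) (nhds 0) := by
      have : Continuous (fun x : ℝ => ((x, 0) : ℝ × Cn d)) := by fun_prop
      exact this.tendsto 0
    filter_upwards [ht.eventually h.eventually_nonneg] with x hx
    rw [ha0]
    exact hx
  have hO := isBigO_norm_pow_of_iteratedFDeriv_eq_zero 2 hcd fun k hk => by
    rw [← norm_eq_zero]
    interval_cases k
    · rw [norm_iteratedFDeriv_zero, ha0, norm_zero]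
    · rw [← norm_iteratedFDeriv_fderiv, norm_iteratedFDeriv_zero, hmin.fderiv_eq_zero, norm_zero]
  obtain ⟨C, hC, hCb⟩ := hO.exists_pos
  obtain ⟨ρ, hρ, hbd⟩ := Metric.eventually_nhds_iff.1 hCb.bound
  -- `r / 2` keeps heights `y * (1 - ζ.re) < 2 * y` in the window, `ρ` is the range of the quadratic
  -- bound, and `1 / (2 * C)` makes `2 * C * y ^ 2 * (1 - ζ.re) < y * (1 - ζ.re)`.
  refine ⟨min (r / 2) (min ρ (1 / (2 * C))), by positivity, fun y hy hyr ζ hζ => ?_⟩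
  have hy1 : y < r / 2 := hyr.trans_le (min_le_left _ _)
  have hy2 : y < ρ := hyr.trans_le ((min_le_right _ _).trans (min_le_left _ _))
  have hy3 : y * (2 * C) < 1 := (lt_div_iff₀ (by positivity)).1
    (hyr.trans_le ((min_le_right _ _).trans (min_le_right _ _)))
  have hre : |ζ.re| < 1 := (Complex.abs_re_le_norm ζ).trans_lt hζ
  have him : |ζ.im| < 1 := (Complex.abs_im_le_norm ζ).trans_lt hζ
  have hsq : ζ.re ^ 2 + ζ.im ^ 2 < 1 := by
    have := Complex.sq_norm ζ
    rw [Complex.normSq_apply] at this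
    nlinarith [norm_nonneg ζ]
  obtain ⟨hre1, hre2⟩ := abs_lt.1 hre
  have hx : |y * ζ.im| < y := by
    rw [abs_mul, abs_of_pos hy]
    exact mul_lt_of_lt_one_right hy him
  have hcoord : (y : ℂ) * Complex.I * (1 - ζ) =
      ((y * ζ.im : ℝ) : ℂ) + ((y * (1 - ζ.re) : ℝ) : ℂ) * Complex.I := by
    apply Complex.ext <;> simp
  rw [hcoord]
  refine (hmem _ _ _ (hx.trans (by linarith)) ?_ (by simpa using hr)).2 ?_
  · rw [abs_of_pos (by nlinarith)]
    nlinarith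
  · have hb : a (y * ζ.im) ≤ C * (y * ζ.im) ^ 2 := by
      have := hbd (y := y * ζ.im) (by rw [dist_zero_right]; exact hx.trans hy2)
      rw [norm_pow, norm_norm, Real.norm_eq_abs, Real.norm_eq_abs, sq_abs] at this
      exact (le_abs_self _).trans this
    have h1 : ζ.im ^ 2 < 2 * (1 - ζ.re) := by nlinarith
    refine hb.trans_lt ?_
    have h2 : C * (y * ζ.im) ^ 2 ≤ C * y ^ 2 * (2 * (1 - ζ.re)) := by
      rw [mul_pow, ← mul_assoc]
      gcongr
    have h3 : 0 < y * (1 - ζ.re) := mul_pos hy (by linarith)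
    nlinarith

/-- At a nearest exit parameter `ζ` the graph has reached height `y`, so `y ≤ F (0, ζ • v) ≤ C * ‖ζ‖
^ N`. -/
lemma exists_pow_lower_bound (h : IsGraphAtZero G F) (hG : IsOpen G)
    (hb : Bornology.IsBounded G) {v : Cn d} (hv : v ≠ 0) {N : ℕ}
    (hN : (N : ℕ∞) ≤ lineOrder (fun z => F (0, z)) v) :
    ∃ C r : ℝ, 0 ≤ C ∧ 0 < r ∧ ∀ y : ℝ, 0 < y → y < r →
      y ≤ C * discRadius G (consPoint ((y : ℂ) * Complex.I) 0) (consPoint 0 v) ^ N := by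
  obtain ⟨r, hr, hmem⟩ := h.mem_iff
  set g : ℂ → ℝ := fun ζ => F (0, ζ • v) with hg
  have hcd : ContDiffAt ℝ ∞ g 0 := by
    refine ContDiffAt.comp (g := F) (f := fun ζ : ℂ => ((0, ζ • v) : ℝ × Cn d)) 0 ?_ ?_
    · simp only [zero_smul]
      exact h.contDiffAt
    · exact contDiffAt_const.prodMk (contDiffAt_id.smul contDiffAt_const)
  have hO := isBigO_norm_pow_of_iteratedFDeriv_eq_zero N hcd fun k hk =>
    iteratedFDeriv_eq_zero_of_lt_vanishingOrder ((Nat.cast_lt.2 hk).trans_le hN)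
  obtain ⟨C, hC, hCb⟩ := hO.exists_pos
  obtain ⟨ρ, hρ, hbd⟩ := Metric.eventually_nhds_iff.1 hCb.bound
  have hv0 : 0 < ‖v‖ := norm_pos_iff.2 hv
  set δ := min ρ (r / ‖v‖) with hδ
  have hδ0 : 0 < δ := by positivity
  -- The bound `C * δ ^ N` covers an exit at distance at least `δ`, where the estimate on `F` is not
  -- available.
  refine ⟨C, min r (C * δ ^ N), hC.le, by positivity, fun y hy hyr => ?_⟩
  have hv' : consPoint 0 v ≠ 0 := by
    intro h0
    apply hv
    ext i
    simpa using congrArg (fun w : Cn (d + 1) => w i.succ) h0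
  obtain ⟨ζ, hζ, hζr⟩ := exists_norm_eq_discRadius hG hb
    (x := consPoint ((y : ℂ) * Complex.I) 0) hv'
  rw [← hζr]
  rcases lt_or_ge ‖ζ‖ δ with hlt | hge
  · have h1 : ‖ζ • v‖ < r := by
      rw [norm_smul]
      exact (lt_div_iff₀ hv0).1 (hlt.trans_le (min_le_right _ _))
    have h2 := hmem 0 y (ζ • v) (by simpa using hr)
      (by rw [abs_of_pos hy]; exact hyr.trans_le (min_le_left _ _)) h1
    rw [smul_consPoint, consPoint_add, mul_zero, add_zero, zero_add] at hζ
    rw [Complex.ofReal_zero, zero_add] at h2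
    have h3 : y ≤ g ζ := not_lt.1 fun hc => hζ (h2.2 hc)
    have h4 := hbd (y := ζ) (by rw [dist_zero_right]; exact hlt.trans_le (min_le_left _ _))
    rw [norm_pow, norm_norm] at h4
    exact h3.trans ((le_abs_self _).trans h4)
  · exact (hyr.trans_le (min_le_right _ _)).le.trans (by gcongr)

/-! ### Rescaling and conclusion. -/

/-- Rescaling near a boundary point of infinite type. -/
lemma exists_normalization (h : IsGraphAtZero G F) (hd : 0 < d) (hG : IsOpen G)
    (hc : Convex ℝ G) (hb : Bornology.IsBounded G)
    (htype : ∀ N : ℕ, ∃ v : Cn d, v ≠ 0 ∧ (N : ℕ∞) ≤ lineOrder (fun z => F (0, z)) v)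
    {ε δ : ℝ} (hε : 0 < ε) (hε1 : ε < 1) (hδ : 0 < δ) :
    ∃ B : Cn (d + 1) ≃ᵃ[ℂ] Cn (d + 1), B 0 ∈ G ∧ ‖B 0‖ < δ ∧ IsNormalized (B ⁻¹' G) ∧
      ∀ ζ : ℂ, ‖ζ‖ < 1 - ε →
        (1 - ε) • (stdVec 0 : Cn (d + 1)) + ζ • stdVec 1 ∈ B ⁻¹' G := by
  obtain ⟨d, rfl⟩ := Nat.exists_eq_succ_of_ne_zero hd.ne'
  obtain ⟨N, hN⟩ := exists_pow_lt_of_lt_one hε (show 1 - ε < 1 by linarith)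
  obtain ⟨v, hv, hvN⟩ := htype N
  obtain ⟨C, r₁, hC, hr₁, hlow⟩ := h.exists_pow_lower_bound hG hb hv hvN
  obtain ⟨r₂, hr₂, hdisc⟩ := h.exists_disc_mem
  obtain ⟨y, hy, hyr, hyD⟩ := exists_mul_le_of_pow_lower_bound
    (D := fun y => discRadius G (consPoint ((y : ℂ) * Complex.I) 0) (consPoint 0 v))
    (fun _ => Metric.infDist_nonneg) hC (r := min δ (min r₁ r₂)) (by positivity)
    (q := 1 - ε) (by linarith) hε hε1.le hN
    fun y hy hyr => hlow y hy (hyr.trans_le ((min_le_right _ _).trans (min_le_left _ _)))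
  have hyδ : y < δ := hyr.trans_le (min_le_left _ _)
  have hy₂ : y < r₂ := hyr.trans_le ((min_le_right _ _).trans (min_le_right _ _))
  set x : Cn (d + 1 + 1) := consPoint ((y : ℂ) * Complex.I) 0 with hx
  set b₀ : Cn (d + 1 + 1) := consPoint (-((y : ℂ) * Complex.I)) 0 with hb₀
  have hxG : x ∈ G := by simpa using hdisc y hy hy₂ 0 (by simp)
  have hdisc₀ : ∀ ζ : ℂ, ‖ζ‖ < 1 → x + ζ • b₀ ∈ G := by
    intro ζ hζ
    convert hdisc y hy hy₂ ζ hζ using 1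
    rw [hx, hb₀, smul_consPoint, consPoint_add, smul_zero, add_zero]
    congr 1
    ring
  have hxb₀ : x + b₀ = 0 := by
    rw [hx, hb₀, consPoint_add, add_neg_cancel, add_zero, consPoint_zero_zero]
  have hv' : (consPoint 0 v : Cn (d + 1 + 1)) ≠ 0 := by
    intro h0
    apply hv
    ext i
    simpa using congrArg (fun w : Cn (d + 1 + 1) => w i.succ) h0
  obtain ⟨ζ₁, hζ₁, hζ₁0, hout, hdisc₁⟩ := exists_normalized_smul hG hb hxG hv'
  let l₀ : Cn (d + 1 + 1) →ₗ[ℂ] ℂ := (EuclideanSpace.proj (0 : Fin (d + 1 + 1)) :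
    Cn (d + 1 + 1) →L[ℂ] ℂ)
  have hl₀ : ∀ w, l₀ w = w 0 := fun w => rfl
  have hfin : Module.finrank ℂ (LinearMap.ker l₀) = d + 1 := by
    have := finrank_inf_ker_add_one (W := ⊤) (l := l₀) (v := b₀) trivial (by
      rw [hl₀, hb₀, consPoint_zero]
      simpa using hy.ne')
    rw [top_inf_eq, finrank_top, finrank_euclideanSpace_fin] at this
    omega
  obtain ⟨b, hbf, hbW, hb0⟩ := exists_isAdaptedFrame_step hG hc hxG hfin
    (v := ζ₁ • consPoint 0 v) (by
      rw [LinearMap.mem_ker, hl₀, smul_consPoint, consPoint_zero, mul_zero]) hdisc₁ hout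
    (exists_isAdaptedFrame hG hc hb hxG d)
  -- As `x + b₀ = 0`, the plane to avoid is the hyperplane of vanishing zeroth coordinate, disjoint
  -- from the upper half space.
  have hframe := hbf.cons hxG hdisc₀ hbW fun w hw hmem => by
    have := h.im_pos _ hmem
    rw [hxb₀, zero_add, ← hl₀, LinearMap.mem_ker.1 hw] at this
    simp at this
  obtain ⟨B, L, hB, hL, hnorm⟩ := hframe.exists_affineEquiv hG hc hxG
  have hB0 : B 0 = x := by rw [hB, map_zero, add_zero]
  refine ⟨B, by rwa [hB0], ?_, hnorm, fun ζ hζ => ?_⟩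
  · rw [hB0, hx, norm_consPoint_left]
    simpa [abs_of_pos hy] using hyδ
  · change B _ ∈ G
    have hL1 : L (stdVec 1) = ζ₁ • consPoint 0 v := (hL 1).trans hb0
    have hL0 : L (stdVec 0) = b₀ := hL 0
    have hBw : B ((1 - ε) • (stdVec 0 : Cn (d + 1 + 1)) + ζ • stdVec 1) =
        consPoint (((ε * y : ℝ) : ℂ) * Complex.I) 0 + (ζ * ζ₁) • consPoint 0 v := by
      rw [hB, ← Complex.coe_smul, map_add, map_smul, map_smul, hL1, hL0, hx, hb₀, smul_smul,
        ← add_assoc, smul_consPoint (((1 - ε : ℝ) : ℂ)), consPoint_add, smul_zero, add_zero]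
      congr 2
      push_cast
      ring
    rw [hBw]
    -- Here `‖ζ₁‖ = D(y)`, so `‖ζ * ζ₁‖ < (1 - ε) * D(y) ≤ D(εy)`.
    refine add_smul_mem_of_norm_lt_discRadius (lt_of_lt_of_le ?_ hyD)
    rw [norm_mul, ← hζ₁]
    gcongr

end IsGraphAtZero

theorem theorem3p2 (d : ℕ) (Ω : Set (Cn (d + 1)))
    (hΩ_open : IsOpen Ω) (hΩ_nonempty : Ω.Nonempty) (hΩ_convex : Convex ℝ Ω)
    (hΩ_bounded : Bornology.IsBounded Ω) (hΩ_smooth : HasSmoothBoundary Ω)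
    (ξ : Cn (d + 1)) (hξ : ξ ∈ frontier Ω)
    (m : Fin d → ℕ∞) (hm : IsLineType Ω ξ m) (hm_inf : ¬ ∀ j, ∃ k : ℕ, m j = k) :
    ∃ (x : ℕ → Cn (d + 1)) (A : ℕ → (Cn (d + 1) ≃ᵃ[ℂ] Cn (d + 1))) (Ω' : Set (Cn (d + 1))),
      (∀ k, x k ∈ Ω) ∧ Filter.Tendsto x Filter.atTop (nhds ξ) ∧
      PointedTendsto (fun k => (A k '' Ω, A k (x k))) (Ω', 0) ∧
      (∀ i : Fin (d + 1), axisDisk i ⊆ Ω') ∧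
      (∀ i : Fin (d + 1), axisPlane i ∩ Ω' = ∅) ∧
      (fun w => stdVec 0 + w) '' axisDisk (1 : Fin (d + 1)) ⊆ frontier Ω' := by
  obtain ⟨T, F, hT, rfl⟩ := hm
  obtain ⟨j, hj⟩ := not_forall.1 hm_inf
  have hj' : typeAtZero (fun z => F (0, z)) j = ⊤ := by
    by_contra hne
    obtain ⟨k, hk⟩ := ENat.ne_top_iff_exists.1 hne
    exact hj ⟨k, hk.symm⟩
  have hd : 0 < d := j.pos
  have hcont : Continuous T := T.toAffineMap.continuous_of_finiteDimensional
  have hcont' : Continuous T.symm := T.symm.toAffineMap.continuous_of_finiteDimensional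
  set G : Set (Cn (d + 1)) := T '' Ω
  have hpre : G = T.symm ⁻¹' Ω := T.toEquiv.image_eq_preimage_symm Ω
  have hG_open : IsOpen G := by
    rw [hpre]
    exact hΩ_open.preimage hcont'
  have hG_convex : Convex ℝ G := by
    have hlin : T.symm ⁻¹' Ω =
        T.symm.linear.toLinearMap.restrictScalars ℝ ⁻¹' ((fun z => T.symm 0 + z) ⁻¹' Ω) := by
      ext w
      have hw : T.symm w = T.symm 0 + T.symm.linear w := by
        have := T.symm.map_vadd 0 w
        rw [vadd_eq_add, vadd_eq_add, add_zero] at this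
        exact this.trans (add_comm _ _)
      change T.symm w ∈ Ω ↔ T.symm 0 + T.symm.linear w ∈ Ω
      rw [hw]
    rw [hpre, hlin]
    exact (hΩ_convex.translate_preimage_right _).linear_preimage _
  have hG_bounded : Bornology.IsBounded G :=
    (hΩ_bounded.isCompact_closure.image hcont).isBounded.subset (Set.image_mono subset_closure)
  have hgraph := hT.isGraphAtZero hξ.1
  -- The choice `ε = 1 / (k + 2)` keeps `ε < 1` even for `k = 0`.
  have hstep : ∀ k : ℕ, ∃ B : Cn (d + 1) ≃ᵃ[ℂ] Cn (d + 1), B 0 ∈ G ∧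
      ‖B 0‖ < 1 / ((k : ℝ) + 1) ∧ IsNormalized (B ⁻¹' G) ∧
      ∀ ζ : ℂ, ‖ζ‖ < 1 - 1 / ((k : ℝ) + 2) →
        (1 - 1 / ((k : ℝ) + 2)) • (stdVec 0 : Cn (d + 1)) + ζ • stdVec 1 ∈ B ⁻¹' G := fun k =>
    hgraph.exists_normalization hd hG_open hG_convex hG_bounded
      (exists_le_lineOrder_of_typeAtZero_eq_top hj') (by positivity)
      (by rw [div_lt_one (by positivity)]; linarith [k.cast_nonneg (α := ℝ)]) (by positivity)
  choose B hB0 hBlim hBnorm hBdisc using hstep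
  obtain ⟨φ, S', hφ, hlim, hS', hfront⟩ := exists_subseq_tendsto_isNormalized hd hBnorm hBdisc
  have himage : ∀ k, (T.trans (B k).symm) '' Ω = B k ⁻¹' G := by
    intro k
    exact (Set.image_comp (B k).symm T Ω).trans ((B k).symm.toEquiv.image_eq_preimage_symm G)
  refine ⟨fun k => T.symm (B (φ k) 0), fun k => T.trans (B (φ k)).symm, S', fun k => ?_, ?_, ?_,
    hS'.axisDisk_subset, hS'.axisPlane_inter, hfront⟩
  · have := hB0 (φ k)
    rwa [hpre] at this
  · have h0 : Filter.Tendsto (fun k => B k 0) Filter.atTop (nhds 0) :=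
      squeeze_zero_norm (fun k => (hBlim k).le) tendsto_one_div_add_atTop_nhds_zero_nat
    have h1 : T.symm 0 = ξ := by rw [← hT.1, T.symm_apply_apply]
    rw [← h1]
    exact (hcont'.tendsto 0).comp (h0.comp hφ.tendsto_atTop)
  · convert hlim using 3 with k
    · exact himage _
    · simp
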